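/- For integers $r\ge 2$ and $k\ge 0$ let $b_r(k)$ denote the Euler binary partition function: the number of different binary expansions $k=\sum_{j=0}^{\infty} d_j 2^j$ with digits $d_j\in\{0,1,\ldots,r-1\}$ (only finitely many of them nonzero). Let $$p_1(r)=\liminf_{k\to\infty}\frac{\log b_r(k)}{\log k},\qquad p_2(r)=\limsup_{k\to\infty}\frac{\log b_r(k)}{\log k}$$ be its lower and upper exponents of growth. Then for every odd $r\ge 3$ we have $p_1(r)<p_2(r)$. -/

import Mathlib

namespace EulerBinary

/-- The binary expansions of `k` with digits in `{0, …, r - 1}`: the finitely supported digit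
sequences `(d_j)` with `0 ≤ d_j < r` for all `j` and `∑ j, d_j * 2 ^ j = k`. -/
def expansions (r k : ℕ) : Set (ℕ →₀ ℕ) :=
  {d | (∀ j, d j < r) ∧ (d.sum fun j a => a * 2 ^ j) = k}

/-- There are finitely many expansions, so that counting them with `Set.ncard` is meaningful. -/
theorem expansions_finite (r k : ℕ) : (expansions r k).Finite := by
  refine (Set.finite_Iic (Finsupp.onFinset (Finset.range (k + 1))
    (fun j => if j ∈ Finset.range (k + 1) then k else 0) (by intro a h; simp at h ⊢; omega))).subset ?_
  rintro d ⟨-, hd⟩ j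
  by_cases hj : d j = 0
  · rw [hj]; exact Nat.zero_le _
  have h1 : d j * 2 ^ j ≤ k := by
    rw [← hd, Finsupp.sum]
    exact Finset.single_le_sum (f := fun j => d j * 2 ^ j) (fun _ _ => Nat.zero_le _)
      (Finsupp.mem_support_iff.mpr hj)
  have h2 : j < 2 ^ j := Nat.lt_two_pow_self
  have h3 : 1 ≤ d j := Nat.one_le_iff_ne_zero.mpr hj
  have h4 : j < k + 1 := by nlinarith
  have h5 : d j ≤ k := le_trans (Nat.le_mul_of_pos_right _ (by positivity)) h1
  rw [Finsupp.onFinset_apply, if_pos (Finset.mem_range.mpr h4)]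
  exact h5

/-- The Euler binary partition function `b_r(k)`: the number of binary expansions of `k` with
digits in `{0, …, r - 1}`. -/
noncomputable def b (r k : ℕ) : ℕ := (expansions r k).ncard

/-- For `r ≥ 2` every `k` has an expansion (the usual binary one), so that `log b_r(k)` is the
logarithm of a positive number. -/
theorem b_pos {r : ℕ} (hr : 2 ≤ r) (k : ℕ) : 0 < b r k := by
  rw [b, Set.ncard_pos (expansions_finite r k)]
  let d : ℕ →₀ ℕ := Finsupp.indicator k.bitIndices.toFinset (fun _ _ => 1)
  have hd : ∀ j, d j = if j ∈ k.bitIndices.toFinset then 1 else 0 := by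
    intro j; simp [d, Finsupp.indicator_apply]
  refine ⟨d, fun j => ?_, ?_⟩
  · rw [hd]; split_ifs <;> omega
  · rw [Finsupp.sum_of_support_subset d (s := k.bitIndices.toFinset) ?_ _ (by simp)]
    · rw [Finset.sum_congr rfl (g := fun j => 2 ^ j) (fun j hj => by rw [hd, if_pos hj, one_mul])]
      exact Finset.sum_toFinset_bitIndices_two_pow k
    · exact Finsupp.support_indicator_subset _ _

/-- The lower exponent of growth `liminf_{k → ∞} log b_r(k) / log k`, an extended real. -/
noncomputable def p₁ (r : ℕ) : EReal :=
  Filter.liminf (fun k : ℕ => ((Real.log (b r k) / Real.log k : ℝ) : EReal)) Filter.atTop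

/-- The upper exponent of growth `limsup_{k → ∞} log b_r(k) / log k`, an extended real. -/
noncomputable def p₂ (r : ℕ) : EReal :=
  Filter.limsup (fun k : ℕ => ((Real.log (b r k) / Real.log k : ℝ) : EReal)) Filter.atTop

end EulerBinary

/-!
Suppose that the two exponents of growth agree. Then `log b_r(k) / log k` converges to a real
number `p`, and `b_r(k)` lies between `x ^ n` and `y ^ n` for `k` on the scale `2 ^ n`, for any
`x < 2 ^ p < y` and large `n` (`eventually_pow_le_b`, `eventually_b_le_pow`).

* There are `r ^ n` sequences of `n` digits, and they represent numbers below `r * 2 ^ n`, so the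
  average of `b_r` on the scale `2 ^ n` is about `(r / 2) ^ n`. Hence `2 ^ p = r / 2`
  (`two_rpow_eq_half`).
* Splitting off the lowest digit shows that `r - 1` consecutive values of `b_r` ending at `2 * k`
  arise from those ending at `k` by a fixed nonnegative integer matrix, `transition r`. All values
  of `b_r` are positive, so the powers of this matrix grow like `(2 ^ p) ^ n`, and by Gelfand's
  formula it has an eigenvalue `z` with `|z| = 2 ^ p` (`exists_mem_spectrum_transition`).

So `|z| ^ 2 = z * conj z = r ^ 2 / 4` is a rational algebraic integer, which forces `r` to be even.
-/

open Finset Filter Topology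

namespace EulerBinary

/-! ### The recursion for `b` -/

/-- The digit sequence with lowest digit `a`, followed by the digits of `e`. -/
noncomputable def consDigit (a : ℕ) (e : ℕ →₀ ℕ) : ℕ →₀ ℕ :=
  Finsupp.single 0 a + e.embDomain ⟨Nat.succ, Nat.succ_injective⟩

@[simp]
theorem consDigit_zero (a : ℕ) (e : ℕ →₀ ℕ) : consDigit a e 0 = a := by
  have : e.embDomain ⟨Nat.succ, Nat.succ_injective⟩ 0 = 0 :=
    Finsupp.embDomain_of_notMem_range _ _ _ (by simp)
  simp [consDigit, this]

@[simp]
theorem consDigit_succ (a : ℕ) (e : ℕ →₀ ℕ) (j : ℕ) : consDigit a e (j + 1) = e j := by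
  have : e.embDomain ⟨Nat.succ, Nat.succ_injective⟩ (j + 1) = e j :=
    Finsupp.embDomain_apply_self ⟨Nat.succ, Nat.succ_injective⟩ e j
  simp [consDigit, this]

theorem sum_consDigit (a : ℕ) (e : ℕ →₀ ℕ) :
    ((consDigit a e).sum fun j x => x * 2 ^ j) = a + 2 * e.sum fun j x => x * 2 ^ j := by
  rw [consDigit, Finsupp.sum_add_index' (by simp) (by intros; ring),
    Finsupp.sum_single_index (by simp), Finsupp.sum_embDomain, Finsupp.mul_sum]
  simp only [pow_zero, mul_one, Function.Embedding.coeFn_mk, Nat.succ_eq_add_one, pow_succ]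
  congr 1
  exact Finsupp.sum_congr fun _ _ => by ring

theorem exists_eq_consDigit (d : ℕ →₀ ℕ) : ∃ e, d = consDigit (d 0) e := by
  refine ⟨d.comapDomain Nat.succ Nat.succ_injective.injOn, ?_⟩
  ext j
  cases j <;> simp [Finsupp.comapDomain_apply]

theorem consDigit_mem_expansions {r a j : ℕ} {e : ℕ →₀ ℕ} (ha : a < r) (he : e ∈ expansions r j) :
    consDigit a e ∈ expansions r (a + 2 * j) := by
  refine ⟨fun i => ?_, by rw [sum_consDigit, he.2]⟩
  cases i <;> simp [ha, he.1]

theorem consDigit_injective {a a' : ℕ} {e e' : ℕ →₀ ℕ} (h : consDigit a e = consDigit a' e') :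
    a = a' ∧ e = e' := by
  refine ⟨by simpa using DFunLike.congr_fun h 0, ?_⟩
  ext j
  simpa using DFunLike.congr_fun h (j + 1)

/-- Splitting off the lowest digit `k - 2 * j` of an expansion of `k` leaves an expansion
of `j`. -/
theorem b_eq_sum_filter (r k N : ℕ) (hN : k < 2 * N) :
    b r k = ∑ j ∈ range N with 2 * j ≤ k ∧ k < 2 * j + r, b r j := by
  have hb : ∀ j, b r j = #(expansions_finite r j).toFinset := fun j =>
    Set.ncard_eq_toFinset_card _ _
  simp only [hb]
  rw [← card_sigma]
  symm
  refine card_bij (fun p _ => consDigit (k - 2 * p.1) p.2) ?_ ?_ ?_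
  · rintro ⟨j, e⟩ hp
    simp only [mem_sigma, mem_filter, mem_range, Set.Finite.mem_toFinset] at hp ⊢
    have := consDigit_mem_expansions (a := k - 2 * j) (by omega) hp.2
    rwa [Nat.sub_add_cancel hp.1.2.1] at this
  · rintro ⟨j, e⟩ hp ⟨j', e'⟩ hp' h
    simp only [mem_sigma, mem_filter, mem_range, Set.Finite.mem_toFinset] at hp hp'
    obtain ⟨h1, rfl⟩ := consDigit_injective h
    dsimp only at h1 hp hp'
    obtain rfl : j = j' := by omega
    rfl
  · intro d hd
    rw [Set.Finite.mem_toFinset] at hd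
    obtain ⟨e, he⟩ := exists_eq_consDigit d
    have hk := hd.2
    rw [he, sum_consDigit] at hk
    have h0 := hd.1 0
    refine ⟨⟨e.sum fun j x => x * 2 ^ j, e⟩, ?_, ?_⟩
    · simp only [mem_sigma, mem_filter, mem_range, Set.Finite.mem_toFinset]
      refine ⟨by omega, fun i => ?_, rfl⟩
      have := hd.1 (i + 1)
      rwa [he, consDigit_succ] at this
    · dsimp only
      rw [he]
      congr 1
      omega

theorem b_zero {r : ℕ} (hr : 0 < r) : b r 0 = 1 := by
  rw [b, Set.ncard_eq_one]
  refine ⟨0, Set.eq_singleton_iff_unique_mem.mpr ⟨⟨fun _ => by simpa, by simp⟩, ?_⟩⟩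
  rintro d ⟨-, hd⟩
  ext j
  simp only [Finsupp.sum, sum_eq_zero_iff] at hd
  by_contra h
  have := hd j (Finsupp.mem_support_iff.mpr h)
  simp_all

theorem b_le_b_two_mul {r : ℕ} (hr : 0 < r) (k : ℕ) : b r k ≤ b r (2 * k) := by
  rw [b_eq_sum_filter r (2 * k) (k + 1) (by omega)]
  exact single_le_sum (f := b r) (fun _ _ => Nat.zero_le _) (by simp [hr])

theorem b_le_b_two_pow_mul {r : ℕ} (hr : 0 < r) (n k : ℕ) : b r k ≤ b r (2 ^ n * k) := by
  induction n with
  | zero => simp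
  | succ n ih =>
    refine ih.trans ((b_le_b_two_mul hr _).trans_eq ?_)
    rw [pow_succ']
    ring_nf

/-! ### The average order of `b` -/

/-- An expansion of `k < 2 ^ n` uses at most the `n` lowest digits. -/
theorem sum_b_le (r n : ℕ) (hr : 0 < r) : ∑ k ∈ range (2 ^ n), b r k ≤ r ^ n := by
  induction n with
  | zero => simp [b_zero hr]
  | succ n ih =>
    calc ∑ k ∈ range (2 ^ (n + 1)), b r k
        = ∑ k ∈ range (2 ^ (n + 1)), ∑ j ∈ range (2 ^ n),
            if 2 * j ≤ k ∧ k < 2 * j + r then b r j else 0 := by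
          refine sum_congr rfl fun k hk => ?_
          rw [b_eq_sum_filter r k (2 ^ n) (by simpa [pow_succ'] using hk), sum_filter]
      _ = ∑ j ∈ range (2 ^ n), ∑ k ∈ range (2 ^ (n + 1)),
            if 2 * j ≤ k ∧ k < 2 * j + r then b r j else 0 := sum_comm
      _ ≤ ∑ j ∈ range (2 ^ n), r * b r j := by
          refine sum_le_sum fun j _ => ?_
          rw [← sum_filter, sum_const, smul_eq_mul]
          refine Nat.mul_le_mul_right _ ?_
          calc _ ≤ #(Ico (2 * j) (2 * j + r)) := card_le_card fun k hk => by
                rw [mem_filter] at hk; exact mem_Ico.mpr hk.2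
            _ = r := by simp
      _ ≤ r ^ (n + 1) := by
          rw [← mul_sum, pow_succ']
          exact Nat.mul_le_mul_left _ ih

/-- Each of the `r ^ n` sequences of `n` digits is an expansion of a number that is at most
`(r - 1) * (2 ^ n - 1)`. -/
theorem le_sum_b (r n : ℕ) (hr : 0 < r) :
    r ^ n ≤ ∑ k ∈ range (r * (2 ^ n - 1) + 1), b r k := by
  induction n with
  | zero => simp [b_zero hr]
  | succ n ih =>
    set N := r * (2 ^ n - 1) with hN
    have hN' : r * (2 ^ (n + 1) - 1) = 2 * N + r := by
      obtain ⟨m, hm⟩ := Nat.exists_eq_add_of_le' (Nat.one_le_two_pow (n := n))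
      rw [hN, pow_succ, hm, Nat.add_sub_cancel,
        show (m + 1) * 2 - 1 = 2 * m + 1 by omega]
      ring
    rw [hN']
    calc r ^ (n + 1) ≤ ∑ j ∈ range (N + 1), r * b r j := by
          rw [← mul_sum, pow_succ']
          exact Nat.mul_le_mul_left _ ih
      _ ≤ ∑ j ∈ range (2 * N + r + 1), ∑ k ∈ range (2 * N + r + 1),
            if 2 * j ≤ k ∧ k < 2 * j + r then b r j else 0 := by
          refine (sum_le_sum fun j hj => ?_).trans
            (sum_le_sum_of_subset (range_mono (by omega : N + 1 ≤ 2 * N + r + 1)))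
          rw [← sum_filter, sum_const, smul_eq_mul]
          refine Nat.mul_le_mul_right _ ?_
          rw [mem_range] at hj
          calc r = #(Ico (2 * j) (2 * j + r)) := by simp
            _ ≤ _ := card_le_card fun k hk => by
                rw [mem_Ico] at hk
                rw [mem_filter, mem_range]
                exact ⟨by omega, hk⟩
      _ = ∑ k ∈ range (2 * N + r + 1), b r k := by
          rw [sum_comm]
          refine sum_congr rfl fun k hk => ?_
          rw [mem_range] at hk
          rw [b_eq_sum_filter r k (2 * N + r + 1) (by omega), sum_filter]

/-! ### The transition matrix -/

/-- The matrix, for `r - 1` consecutive values of `b r`, of the step from `k` to `2 * k`. -/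
def transition (r : ℕ) : Matrix (Fin (r - 1)) (Fin (r - 1)) ℕ :=
  Matrix.of fun i j => if (i : ℕ) ≤ 2 * j ∧ 2 * (j : ℕ) < i + r then 1 else 0

/-- The vector `(b r k, b r (k - 1), …, b r (k - (r - 2)))`. -/
noncomputable def window (r k : ℕ) : Fin (r - 1) → ℕ := fun i => b r (k - i)

open Matrix in
theorem transition_mulVec_window {r k : ℕ} (hk : r ≤ k) :
    transition r *ᵥ window r k = window r (2 * k) := by
  ext i
  have hi := i.2
  simp only [mulVec, dotProduct, transition, Matrix.of_apply, window, ite_mul, one_mul, zero_mul]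
  rw [b_eq_sum_filter r (2 * k - i) (k + 1) (by omega), ← sum_filter]
  refine sum_bij (fun j _ => k - j) ?_ ?_ ?_ fun _ _ => rfl
  · intro j hj
    have := j.2
    simp only [mem_filter, mem_univ, true_and, mem_range] at hj ⊢
    omega
  · intro j _ j' _ h
    have := j.2
    have := j'.2
    ext
    omega
  · intro j hj
    simp only [mem_filter, mem_univ, true_and, mem_range] at hj ⊢
    exact ⟨⟨k - j, by omega⟩, by dsimp only; omega, by dsimp only; omega⟩

open Matrix in
theorem transition_pow_mulVec_window {r k : ℕ} (hk : r ≤ k) (n : ℕ) :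
    transition r ^ n *ᵥ window r k = window r (2 ^ n * k) := by
  induction n with
  | zero => simp
  | succ n ih =>
    have h : r ≤ 2 ^ n * k := hk.trans (Nat.le_mul_of_pos_left _ (by positivity))
    rw [pow_succ', ← mulVec_mulVec, ih, transition_mulVec_window h, pow_succ', mul_assoc]

/-! ### Spectral radius and growth of powers -/

theorem le_of_eventually_pow_le {x y C : ℝ} (hy : 0 < y)
    (h : ∀ᶠ n : ℕ in atTop, x ^ n ≤ C * y ^ n) : x ≤ y := by
  by_contra! hxy
  have h1 : Tendsto (fun n : ℕ => (x / y) ^ n) atTop atTop :=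
    tendsto_pow_atTop_atTop_of_one_lt ((one_lt_div hy).mpr hxy)
  obtain ⟨n, hn, hn'⟩ := (h.and (h1.eventually_gt_atTop C)).exists
  rw [div_pow, lt_div_iff₀ (by positivity)] at hn'
  linarith

/-- If the norms of the powers of `a` grow like `c ^ n`, up to subexponential factors, then `a` has
a spectral value of modulus `c`: by Gelfand's formula `c` is the spectral radius. -/
theorem exists_mem_spectrum_norm_eq {A : Type*} [NormedRing A] [NormedAlgebra ℂ A]
    [CompleteSpace A] [Nontrivial A] {a : A} {c : ℝ} (hc : 0 < c)
    (hlow : ∀ x, 0 < x → x < c → ∃ C : ℝ, ∀ᶠ n : ℕ in atTop, x ^ n ≤ C * ‖a ^ n‖)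
    (hup : ∀ x, c < x → ∀ᶠ n : ℕ in atTop, ‖a ^ n‖ ≤ x ^ n) :
    ∃ z ∈ spectrum ℂ a, ‖z‖ = c := by
  obtain ⟨z, hz, hρ⟩ := spectrum.exists_nnnorm_eq_spectralRadius a
  refine ⟨z, hz, le_antisymm (le_of_forall_gt_imp_ge_of_dense fun x hx => ?_) ?_⟩
  · refine le_of_eventually_pow_le (C := ‖(1 : A)‖) (hc.trans hx) ?_
    filter_upwards [hup x hx] with n hn
    have h := spectrum.norm_le_norm_mul_of_mem (spectrum.pow_mem_pow a n hz)
    rw [norm_pow] at h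
    nlinarith [norm_nonneg (1 : A)]
  · by_contra! hlt
    obtain ⟨y, hzy, hyc⟩ := exists_between hlt
    obtain ⟨x, hyx, hxc⟩ := exists_between hyc
    have hy : 0 < y := (norm_nonneg z).trans_lt hzy
    obtain ⟨C, hC⟩ := hlow x (hy.trans hyx) hxc
    have hev := (spectrum.pow_norm_pow_one_div_tendsto_nhds_spectralRadius a).eventually_lt_const
      (u := ENNReal.ofReal y) (by
        rw [← hρ, ← enorm_eq_nnnorm, ← ofReal_norm]
        exact (ENNReal.ofReal_lt_ofReal_iff hy).mpr hzy)
    refine hyx.not_ge (le_of_eventually_pow_le (C := |C|) hy ?_)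
    filter_upwards [hC, hev, eventually_gt_atTop 0] with n h1 h2 hn
    rw [ENNReal.ofReal_lt_ofReal_iff hy] at h2
    have h3 : ‖a ^ n‖ ≤ y ^ n := by
      have := pow_le_pow_left₀ (by positivity) h2.le n
      rwa [one_div, Real.rpow_inv_natCast_pow (norm_nonneg _) hn.ne'] at this
    calc x ^ n ≤ C * ‖a ^ n‖ := h1
      _ ≤ |C| * ‖a ^ n‖ := by gcongr; exact le_abs_self C
      _ ≤ |C| * y ^ n := by gcongr

/-- The square `z * conj z` of the modulus is an algebraic integer along with `z`. -/
theorem isIntegral_norm_sq_of_mem_spectrum {ι : Type*} [Fintype ι] [DecidableEq ι]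
    (M : Matrix ι ι ℕ) {z : ℂ} (hz : z ∈ spectrum ℂ (M.map (Nat.castRingHom ℂ))) :
    IsIntegral ℤ ((‖z‖ : ℂ) ^ 2) := by
  have hM : M.map (Nat.castRingHom ℂ)
      = (M.map (Nat.castRingHom ℤ)).map (Int.castRingHom ℂ) := by
    ext; simp
  rw [hM, Matrix.mem_spectrum_iff_isRoot_charpoly, Matrix.charpoly_map] at hz
  have hint : IsIntegral ℤ z := ⟨_, Matrix.charpoly_monic _, by
    simpa [Polynomial.IsRoot, Polynomial.eval_map] using hz⟩
  have hconj : IsIntegral ℤ (starRingEnd ℂ z) := hint.map (starRingEnd ℂ).toIntAlgHom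
  rw [← Complex.mul_conj']
  exact hint.mul hconj

/-- A half-integer whose square is an algebraic integer is an integer. -/
theorem even_of_isIntegral_half_sq {r : ℕ} (h : IsIntegral ℤ (((r / 2 : ℝ) : ℂ) ^ 2)) :
    Even r := by
  have h' : IsIntegral ℤ ((r / 2 : ℚ) ^ 2) := by
    refine (isIntegral_algHom_iff (Algebra.ofId ℚ ℂ |>.restrictScalars ℤ)
      (algebraMap ℚ ℂ).injective).mp ?_
    simpa using h
  obtain ⟨y, hy⟩ := IsIntegrallyClosed.isIntegral_iff.mp (h'.of_pow two_pos)
  have : (r : ℤ) = 2 * y := by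
    have h2 : (y : ℚ) = r / 2 := by simpa using hy
    have h3 : (r : ℚ) = 2 * y := by rw [h2]; ring
    exact_mod_cast h3
  exact (Int.even_coe_nat r).mp (this ▸ even_two_mul y)

/-! ### Consequences of a common exponent of growth -/

theorem le_b {r : ℕ} (hr : 2 ≤ r) (k : ℕ) : (1 : ℝ) ≤ b r k := by
  exact_mod_cast b_pos hr k

theorem log_b_div_log_nonneg {r : ℕ} (hr : 2 ≤ r) (k : ℕ) :
    0 ≤ Real.log (b r k) / Real.log k :=
  div_nonneg (Real.log_nonneg (le_b hr k)) (Real.log_natCast_nonneg k)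

theorem log_b_div_log_le {r k : ℕ} (hr : 2 ≤ r) (hk : 2 ≤ k) :
    Real.log (b r k) / Real.log k ≤ 2 * Real.log r / Real.log 2 := by
  set n := Nat.log 2 k with hn
  have hn1 : 1 ≤ n := Nat.log_pos one_lt_two hk
  have h1 : 2 ^ n ≤ k := Nat.pow_log_le_self 2 (by omega)
  have h2 : k < 2 ^ (n + 1) := Nat.lt_pow_succ_log_self one_lt_two k
  have h3 : b r k ≤ r ^ (2 * n) :=
    calc b r k ≤ ∑ j ∈ range (2 ^ (n + 1)), b r j :=
          single_le_sum (f := b r) (fun _ _ => Nat.zero_le _) (mem_range.mpr h2)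
      _ ≤ r ^ (n + 1) := sum_b_le r _ (by omega)
      _ ≤ r ^ (2 * n) := Nat.pow_le_pow_right (by omega) (by omega)
  have hlog2 : 0 < Real.log 2 := Real.log_pos one_lt_two
  have hlogr : 0 ≤ Real.log r := Real.log_natCast_nonneg r
  have h4 : Real.log (b r k) ≤ 2 * n * Real.log r := by
    have := Real.log_le_log (zero_lt_one.trans_le (le_b hr k))
      (by exact_mod_cast h3 : (b r k : ℝ) ≤ (r : ℝ) ^ (2 * n))
    simpa [Real.log_pow] using this
  have h5 : n * Real.log 2 ≤ Real.log k := by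
    rw [← Real.log_pow]
    exact Real.log_le_log (by positivity) (by exact_mod_cast h1)
  have hk0 : 0 < Real.log k := Real.log_pos (by exact_mod_cast hk)
  rw [div_le_div_iff₀ hk0 hlog2]
  nlinarith [mul_le_mul_of_nonneg_right h4 hlog2.le, mul_le_mul_of_nonneg_left h5 hlogr]

theorem exists_tendsto_of_exponents_eq {r : ℕ} (hr : 2 ≤ r) (h : p₁ r = p₂ r) :
    ∃ p : ℝ, Tendsto (fun k : ℕ => Real.log (b r k) / Real.log k) atTop (𝓝 p) := by
  have hT : Tendsto (fun k : ℕ => ((Real.log (b r k) / Real.log k : ℝ) : EReal)) atTop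
      (𝓝 (p₁ r)) := tendsto_of_liminf_eq_limsup rfl h.symm
  have h0 : ((0 : ℝ) : EReal) ≤ p₁ r := ge_of_tendsto' hT fun k =>
    EReal.coe_le_coe_iff.mpr (log_b_div_log_nonneg hr k)
  have h1 : p₁ r ≤ ((2 * Real.log r / Real.log 2 : ℝ) : EReal) := le_of_tendsto hT <| by
    filter_upwards [eventually_ge_atTop 2] with k hk
    exact EReal.coe_le_coe_iff.mpr (log_b_div_log_le hr hk)
  lift p₁ r to ℝ using ⟨(h1.trans_lt (EReal.coe_lt_top _)).ne,
    ((EReal.bot_lt_coe _).trans_le h0).ne'⟩ with p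
  exact ⟨p, EReal.tendsto_coe.mp hT⟩

section Exponent

variable {r : ℕ} {p : ℝ}

theorem eventually_pow_le_b (hr : 2 ≤ r)
    (hp : Tendsto (fun k : ℕ => Real.log (b r k) / Real.log k) atTop (𝓝 p))
    {x : ℝ} (hx : 0 < x) (hxp : x < 2 ^ p) :
    ∀ᶠ n : ℕ in atTop, ∀ k, 2 ^ n ≤ k → x ^ n ≤ b r k := by
  rcases le_or_gt x 1 with hx1 | hx1
  · exact .of_forall fun n k _ => (pow_le_one₀ hx.le hx1).trans (le_b hr k)
  have hlog2 : 0 < Real.log 2 := Real.log_pos one_lt_two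
  have hq : Real.log x / Real.log 2 < p := by
    rw [div_lt_iff₀ hlog2, ← Real.log_rpow two_pos]
    exact Real.log_lt_log hx hxp
  have hq0 : 0 < Real.log x / Real.log 2 := div_pos (Real.log_pos hx1) hlog2
  obtain ⟨K, hK⟩ := eventually_atTop.mp (hp.eventually_const_lt hq)
  filter_upwards [eventually_ge_atTop K, eventually_gt_atTop 0] with n hn hn0 k hk
  have hkn : n < k := Nat.lt_two_pow_self.trans_le hk
  have hk1 : (1 : ℝ) < k := by exact_mod_cast (by omega : 1 < k)
  have h1 := (lt_div_iff₀ (Real.log_pos hk1)).mp (hK k (by omega))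
  have h2 : n * Real.log 2 ≤ Real.log k := by
    rw [← Real.log_pow]
    exact Real.log_le_log (by positivity) (by exact_mod_cast hk)
  refine (Real.log_le_log_iff (by positivity) (by linarith [le_b hr k])).mp ?_
  calc Real.log (x ^ n) = Real.log x / Real.log 2 * (n * Real.log 2) := by
        rw [Real.log_pow]
        field_simp
    _ ≤ Real.log x / Real.log 2 * Real.log k := by gcongr
    _ ≤ Real.log (b r k) := h1.le

/-- The exponent controls `b r k` on the scale `2 ^ n`, uniformly in `2 ^ n ≤ k ≤ m * 2 ^ n`. -/
theorem eventually_b_le_pow (hr : 2 ≤ r)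
    (hp : Tendsto (fun k : ℕ => Real.log (b r k) / Real.log k) atTop (𝓝 p))
    {x : ℝ} (hxp : 2 ^ p < x) (m : ℕ) :
    ∀ᶠ n : ℕ in atTop, ∀ k, 2 ^ n ≤ k → k ≤ m * 2 ^ n → (b r k : ℝ) ≤ x ^ n := by
  have hx : 0 < x := lt_trans (by positivity) hxp
  have hlog2 : 0 < Real.log 2 := Real.log_pos one_lt_two
  have hp0 : 0 ≤ p := ge_of_tendsto' hp (log_b_div_log_nonneg hr)
  have hpx : p < Real.log x / Real.log 2 := by
    rw [lt_div_iff₀ hlog2, ← Real.log_rpow two_pos]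
    exact Real.log_lt_log (by positivity) hxp
  obtain ⟨q, hpq, hqx⟩ := exists_between hpx
  have hq0 : 0 < q := hp0.trans_lt hpq
  have hgap : 0 < Real.log x - q * Real.log 2 := by
    rw [lt_div_iff₀ hlog2] at hqx
    linarith
  obtain ⟨K, hK⟩ := eventually_atTop.mp (hp.eventually_lt_const hpq)
  -- The slack `log x - q * log 2` per doubling eventually absorbs the factor `m`.
  have hm := (tendsto_natCast_atTop_atTop (R := ℝ)).atTop_mul_const hgap
    |>.eventually_ge_atTop (q * Real.log m)
  filter_upwards [eventually_ge_atTop K, eventually_gt_atTop 0, hm] with n hn hn0 hnm k hk hkm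
  have hkn : n < k := Nat.lt_two_pow_self.trans_le hk
  have hk1 : (1 : ℝ) < k := by exact_mod_cast (by omega : 1 < k)
  have hm0 : (m : ℝ) ≠ 0 := by
    rintro h
    obtain rfl : m = 0 := by exact_mod_cast h
    omega
  have h1 := (div_lt_iff₀ (Real.log_pos hk1)).mp (hK k (by omega))
  have h2 : Real.log k ≤ Real.log m + n * Real.log 2 := by
    rw [← Real.log_pow, ← Real.log_mul hm0 (by positivity)]
    exact Real.log_le_log (by linarith) (by exact_mod_cast hkm)
  refine (Real.log_le_log_iff (by linarith [le_b hr k]) (by positivity)).mp ?_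
  rw [Real.log_pow]
  linarith [mul_le_mul_of_nonneg_left h2 hq0.le]

/-- The average of `b r k` over `k < 2 ^ n` is `(r / 2) ^ n` up to a bounded factor, which
determines the exponent. -/
theorem two_rpow_eq_half (hr : 2 ≤ r)
    (hp : Tendsto (fun k : ℕ => Real.log (b r k) / Real.log k) atTop (𝓝 p)) :
    (2 : ℝ) ^ p = r / 2 := by
  have hr0 : (0 : ℝ) < r := by positivity
  have hc : (0 : ℝ) < 2 ^ p := by positivity
  refine le_antisymm (le_of_forall_lt_imp_le_of_dense fun x hx => ?_)
    (le_of_forall_gt_imp_ge_of_dense fun x hx => ?_)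
  · rcases le_or_gt x 0 with hx0 | hx0
    · exact hx0.trans (by positivity)
    rw [le_div_iff₀ two_pos]
    refine le_of_eventually_pow_le (C := r) hr0 ?_
    filter_upwards [eventually_pow_le_b hr hp hx0 hx] with n hn
    calc (x * 2) ^ n = ∑ k ∈ Ico (2 ^ n) (2 ^ (n + 1)), x ^ n := by
          rw [sum_const, Nat.card_Ico, pow_succ, Nat.mul_two, Nat.add_sub_cancel, mul_pow,
            nsmul_eq_mul]
          push_cast
          ring
      _ ≤ ∑ k ∈ Ico (2 ^ n) (2 ^ (n + 1)), (b r k : ℝ) :=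
          sum_le_sum fun k hk => hn k (mem_Ico.mp hk).1
      _ ≤ ∑ k ∈ range (2 ^ (n + 1)), (b r k : ℝ) :=
          sum_le_sum_of_subset_of_nonneg (fun k hk => mem_range.mpr (mem_Ico.mp hk).2)
            fun _ _ _ => Nat.cast_nonneg _
      _ ≤ (r : ℝ) ^ (n + 1) := by exact_mod_cast sum_b_le r (n + 1) (by omega)
      _ = r * (r : ℝ) ^ n := pow_succ' _ _
  · have hx0 : 0 < x := hc.trans hx
    rw [div_le_iff₀ two_pos]
    refine le_of_eventually_pow_le (C := r) (by positivity) ?_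
    filter_upwards [eventually_b_le_pow hr hp hx r] with n hn
    have hb : ∀ k, k ≤ r * 2 ^ n → (b r k : ℝ) ≤ x ^ n := by
      -- Doubling `k` does not decrease `b r k`, and brings small `k > 0` to the scale `2 ^ n`.
      have hpos : ∀ k, 0 < k → k ≤ r * 2 ^ n → (b r k : ℝ) ≤ x ^ n := by
        intro k hk0 hk
        rcases le_or_gt (2 ^ n) k with hkn | hkn
        · exact hn k hkn hk
        · set l := Nat.log 2 k
          have h1 : 2 ^ l ≤ k := Nat.pow_log_le_self 2 hk0.ne'
          have h2 : k < 2 ^ (l + 1) := Nat.lt_pow_succ_log_self one_lt_two k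
          have hl : l ≤ n := (Nat.pow_lt_pow_iff_right one_lt_two).mp (h1.trans_lt hkn) |>.le
          have h3 : 2 ^ (n - l) * 2 ^ l = 2 ^ n := by rw [← pow_add, Nat.sub_add_cancel hl]
          have h4 : 2 ^ n ≤ 2 ^ (n - l) * k := h3 ▸ Nat.mul_le_mul_left _ h1
          have h5 : 2 ^ (n - l) * k ≤ 2 * 2 ^ n := by
            rw [← h3, pow_succ] at *
            nlinarith [Nat.mul_le_mul_left (2 ^ (n - l)) h2.le]
          refine le_trans ?_ (hn _ h4 (h5.trans (Nat.mul_le_mul_right _ hr)))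
          exact_mod_cast b_le_b_two_pow_mul (by omega) _ _
      intro k hk
      rcases Nat.eq_zero_or_pos k with rfl | hk0
      · rw [b_zero (by omega), Nat.cast_one]
        exact (le_b hr 1).trans (hpos 1 one_pos (Nat.one_le_iff_ne_zero.mpr (by positivity)))
      · exact hpos k hk0 hk
    have hN : r * (2 ^ n - 1) + 1 ≤ r * 2 ^ n := by
      obtain ⟨m, hm⟩ := Nat.exists_eq_add_of_le' (Nat.one_le_two_pow (n := n))
      rw [hm, Nat.add_sub_cancel, mul_add]
      omega
    calc (r : ℝ) ^ n ≤ ∑ k ∈ range (r * (2 ^ n - 1) + 1), (b r k : ℝ) := by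
          exact_mod_cast le_sum_b r n (by omega)
      _ ≤ ∑ k ∈ range (r * (2 ^ n - 1) + 1), x ^ n :=
          sum_le_sum fun k hk => hb k ((mem_range.mp hk).le.trans hN)
      _ = ((r * (2 ^ n - 1) + 1 : ℕ) : ℝ) * x ^ n := by rw [sum_const, card_range, nsmul_eq_mul]
      _ ≤ ((r * 2 ^ n : ℕ) : ℝ) * x ^ n := by gcongr
      _ = r * (x * 2) ^ n := by push_cast; ring

attribute [local instance] Matrix.linftyOpNormedRing Matrix.linftyOpNormedAlgebra

/-- The entries of `transition r ^ n` are controlled by the values of `b r` on the scale `2 ^ n`,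
because the matrix maps the positive vector `window r r` to `window r (2 ^ n * r)`. -/
theorem exists_mem_spectrum_transition (hr : 2 ≤ r)
    (hp : Tendsto (fun k : ℕ => Real.log (b r k) / Real.log k) atTop (𝓝 p)) :
    ∃ z ∈ spectrum ℂ ((transition r).map (Nat.castRingHom ℂ)), ‖z‖ = 2 ^ p := by
  have : NeZero (r - 1) := ⟨by omega⟩
  have hentry : ∀ n (i : Fin (r - 1)),
      ∑ j, ‖((transition r).map (Nat.castRingHom ℂ) ^ n) i j‖₊
        = ((∑ j, (transition r ^ n) i j : ℕ) : NNReal) := by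
    intro n i
    have hpow : (transition r).map (Nat.castRingHom ℂ) ^ n
        = (transition r ^ n).map (Nat.castRingHom ℂ) :=
      (map_pow (Nat.castRingHom ℂ).mapMatrix (transition r) n).symm
    rw [hpow, Nat.cast_sum]
    exact sum_congr rfl fun j _ => by simp
  have hwin : ∀ n (i : Fin (r - 1)),
      ∑ j, (transition r ^ n) i j * window r r j = b r (2 ^ n * r - i) := fun n i =>
    congrFun (transition_pow_mulVec_window (le_refl r) n) i
  refine exists_mem_spectrum_norm_eq (by positivity) (fun x hx hxp => ?_) fun x hxp => ?_
  · refine ⟨(∑ j, window r r j : ℕ), ?_⟩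
    filter_upwards [eventually_pow_le_b hr hp hx hxp] with n hn
    have h1 := hn (2 ^ n * r) (Nat.le_mul_of_pos_right _ (by omega))
    have h2 : b r (2 ^ n * r) ≤ (∑ j, window r r j) * ∑ j, (transition r ^ n) 0 j := by
      have := hwin n 0
      rw [Fin.val_zero, Nat.sub_zero] at this
      rw [← this, mul_sum]
      refine sum_le_sum fun j _ => ?_
      rw [mul_comm]
      exact Nat.mul_le_mul_right _
        (single_le_sum (f := window r r) (fun _ _ => Nat.zero_le _) (mem_univ j))
    have h3 : ((∑ j, (transition r ^ n) 0 j : ℕ) : ℝ)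
        ≤ ‖(transition r).map (Nat.castRingHom ℂ) ^ n‖ := by
      rw [Matrix.linfty_opNorm_def, ← NNReal.coe_natCast, NNReal.coe_le_coe, ← hentry n 0]
      exact le_sup (f := fun i => ∑ j, ‖((transition r).map (Nat.castRingHom ℂ) ^ n) i j‖₊)
        (mem_univ 0)
    calc x ^ n ≤ (b r (2 ^ n * r) : ℝ) := h1
      _ ≤ (∑ j, window r r j : ℕ) * (∑ j, (transition r ^ n) 0 j : ℕ) := by exact_mod_cast h2
      _ ≤ _ := mul_le_mul_of_nonneg_left h3 (Nat.cast_nonneg _)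
  · have hx0 : 0 < x := lt_trans (by positivity) hxp
    filter_upwards [eventually_b_le_pow hr hp hxp r] with n hn
    rw [Matrix.linfty_opNorm_def, ← Real.coe_toNNReal (x ^ n) (by positivity), NNReal.coe_le_coe]
    refine Finset.sup_le fun i _ => ?_
    rw [hentry, ← NNReal.coe_le_coe, Real.coe_toNNReal (x ^ n) (by positivity),
      NNReal.coe_natCast]
    have hi := i.2
    have h1 : ∑ j, (transition r ^ n) i j ≤ b r (2 ^ n * r - i) := by
      rw [← hwin]
      exact sum_le_sum fun j _ => Nat.le_mul_of_pos_right _ (b_pos hr _)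
    have h2 : 2 ^ n + i ≤ 2 ^ n * r := by
      have h := Nat.le_mul_of_pos_left (r - 1) (Nat.two_pow_pos n)
      rw [Nat.mul_sub_one] at h
      have := Nat.le_mul_of_pos_right (2 ^ n) (by omega : 0 < r)
      omega
    have h3 := hn (2 ^ n * r - i) (by omega) (by rw [mul_comm r]; omega)
    exact le_trans (Nat.cast_le.mpr h1) h3

end Exponent

end EulerBinary

open EulerBinary in
theorem mainTheorem7 (r : ℕ) (hr : Odd r) (hr3 : 3 ≤ r) :
    EulerBinary.p₁ r < EulerBinary.p₂ r := by
  refine lt_of_le_of_ne (Filter.liminf_le_limsup) fun h => ?_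
  obtain ⟨p, hp⟩ := exists_tendsto_of_exponents_eq (by omega) h
  obtain ⟨z, hz, hzp⟩ := exists_mem_spectrum_transition (by omega) hp
  have hint := isIntegral_norm_sq_of_mem_spectrum _ hz
  rw [hzp, two_rpow_eq_half (by omega) hp] at hint
  exact Nat.not_even_iff_odd.mpr hr (even_of_isIntegral_half_sq hint)
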